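/- Let $\mathfrak A$ be a unital C*-algebra. Put $$\mathcal P(\mathfrak A)=\{p\in\mathfrak A\mid p=p^2=p^*\},\qquad \mathcal U(\mathfrak A)=\{a\in\mathfrak A\mid aa^*\in\mathcal P(\mathfrak A),\ a^*a\in\mathcal P(\mathfrak A)\},$$ with the norm topology, and let $\mathcal U(\mathfrak A)\rightrightarrows\mathcal P(\mathfrak A)$ be the groupoid with source $\mathbf s(a)=a^*a$, target $\mathbf t(a)=aa^*$, product $ab$ (the product in $\mathfrak A$) defined when $\mathbf s(a)=\mathbf t(b)$, identity $\mathbf 1_p=p$, and inverse $\mathbf i(a)=a^*$. Manifolds are real analytic Banach manifolds, whose model Banach space may vary with the point. A submanifold is a closed, topologically embedded subset whose inclusion map is real analytic and has injective tangent maps with split (i.e. closed and complemented) range. A real analytic submersion is a surjective real analytic map whose tangent maps are surjective with split kernels. A real analytic Banach-Lie groupoid is a topological groupoid $\mathcal G\rightrightarrows M$ (structure maps continuous, $\mathbf s,\mathbf t$ open and surjective, $\mathbf 1$ an embedding, $\mathbf i$ a homeomorphism) whose arrow space $\mathcal G$ and base $M$ are Hausdorff real analytic Banach manifolds, whose source map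 is a real analytic submersion, whose set $\mathcal G^{(2)}$ of composable pairs is a submanifold of $\mathcal G\times\mathcal G$, and whose structure maps $\mathbf t$, $\mathbf i$, $\mathbf 1$ and $\mathbf m\colon\mathcal G^{(2)}\to\mathcal G$ are real analytic. It is locally transitive if for every $x\in M$ the orbit $\{\mathbf t(g)\mid \mathbf s(g)=x\}$ is open in $M$. **Theorem.** The sets $\mathcal U(\mathfrak A)$ and $\mathcal P(\mathfrak A)$ are real analytic submanifolds of the real Banach space $\mathfrak A$, and with these manifold structures $\mathcal U(\mathfrak A)\rightrightarrows\mathcal P(\mathfrak A)$ is a real analytic Banach-Lie groupoid. This groupoid is locally transitive. Its isotropy group at $\mathbf 1\in\mathcal P(\mathfrak A)$, namely $\{a\in\mathcal U(\mathfrak A)\mid \mathbf s(a)=\mathbf t(a)=\mathbf 1\}$, is the Banach-Lie group of unitary elements of $\mathfrak A$: the isotropy group is a submanifold of $\mathcal U(\mathfrak A)$, the unitary group is a submanifold of $\mathfrak A$, both are real analytic Banach-Lie groups for these structures, and the identity map $a\mapsto a$ is a group isomorphism and a real analytic diffeomorphism between them. -/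

import Mathlib

universe u v w

/-! ## Real analytic Banach manifolds

The model Banach space of a Banach manifold may change from one connected component to another
(as it does for the set of projections of a C*-algebra). Mathlib manifolds have one fixed model
space, so the atlases used here carry a family of models. -/

/-- A real analytic Banach manifold structure on a topological space `M`: around each point `x` a
homeomorphism from an open neighbourhood of `x` onto an open subset of a real Banach space
`Model x`, such that all the transition maps are real analytic. -/
structure AnalyticAtlas (M : Type u) [TopologicalSpace M] where
  /-- The Banach space in which the chart around `x` takes its values;
  it also serves as the tangent space at `x`. -/
  Model : M → Type u
  [normedAddCommGroup : ∀ x, NormedAddCommGroup (Model x)]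
  [normedSpace : ∀ x, NormedSpace ℝ (Model x)]
  [completeSpace : ∀ x, CompleteSpace (Model x)]
  /-- The chart around `x`. -/
  chart : ∀ x, OpenPartialHomeomorph M (Model x)
  mem_source : ∀ x, x ∈ (chart x).source
  analyticOn_transition : ∀ x y,
    AnalyticOnNhd ℝ ((chart x).symm.trans (chart y)) ((chart x).symm.trans (chart y)).source

attribute [instance] AnalyticAtlas.normedAddCommGroup AnalyticAtlas.normedSpace
  AnalyticAtlas.completeSpace

namespace AnalyticAtlas

/-- A real Banach space as a real analytic Banach manifold, with the identity as its chart. -/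
def ofBanach (E : Type u) [NormedAddCommGroup E] [NormedSpace ℝ E] [CompleteSpace E] :
    AnalyticAtlas E where
  Model := fun _ => E
  chart := fun _ => OpenPartialHomeomorph.refl E
  mem_source := fun x => Set.mem_univ x
  analyticOn_transition := fun _ _ _ _ => analyticAt_id

/-- The product of two real analytic Banach manifolds. -/
noncomputable def prod {M : Type u} {N : Type v} [TopologicalSpace M] [TopologicalSpace N]
    (𝒜 : AnalyticAtlas M) (ℬ : AnalyticAtlas N) : AnalyticAtlas (M × N) where
  Model := fun x => 𝒜.Model x.1 × ℬ.Model x.2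
  chart := fun x => (𝒜.chart x.1).prod (ℬ.chart x.2)
  mem_source := fun x => ⟨𝒜.mem_source x.1, ℬ.mem_source x.2⟩
  analyticOn_transition := by
    intro x y z hz
    simp only [OpenPartialHomeomorph.trans_source, OpenPartialHomeomorph.symm_source,
      OpenPartialHomeomorph.prod_target, OpenPartialHomeomorph.prod_source, Set.mem_inter_iff,
      Set.mem_prod, Set.mem_preimage, OpenPartialHomeomorph.prod_symm_apply] at hz
    obtain ⟨⟨h1, h2⟩, h3, h4⟩ := hz
    have k1 := 𝒜.analyticOn_transition x.1 y.1 z.1 (by simp [h1, h3])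
    have k2 := ℬ.analyticOn_transition x.2 y.2 z.2 (by simp [h2, h4])
    exact (k1.fun_comp analyticAt_fst).prod (k2.fun_comp analyticAt_snd)

end AnalyticAtlas

section Maps

variable {M : Type u} {N : Type v} [TopologicalSpace M] [TopologicalSpace N]

/-- The expression of `f` in the charts around `x` and `f x`. -/
def chartExpr (𝒜 : AnalyticAtlas M) (ℬ : AnalyticAtlas N) (f : M → N) (x : M) :
    𝒜.Model x → ℬ.Model (f x) :=
  fun v => ℬ.chart (f x) (f ((𝒜.chart x).symm v))

/-- Real analytic maps between real analytic Banach manifolds. -/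
def IsAnalyticMap (𝒜 : AnalyticAtlas M) (ℬ : AnalyticAtlas N) (f : M → N) : Prop :=
  Continuous f ∧ ∀ x, AnalyticAt ℝ (chartExpr 𝒜 ℬ f x) (𝒜.chart x x)

/-- The tangent map of `f` at `x`, where the tangent spaces are identified with the model spaces
through the charts around `x` and `f x`. -/
noncomputable def tangentAt (𝒜 : AnalyticAtlas M) (ℬ : AnalyticAtlas N) (f : M → N) (x : M) :
    𝒜.Model x →L[ℝ] ℬ.Model (f x) :=
  fderiv ℝ (chartExpr 𝒜 ℬ f x) (𝒜.chart x x)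

/-- Real analytic submersions: surjective real analytic maps whose tangent maps are all surjective
with split kernel. -/
def IsAnalyticSubmersion (𝒜 : AnalyticAtlas M) (ℬ : AnalyticAtlas N) (f : M → N) : Prop :=
  IsAnalyticMap 𝒜 ℬ f ∧ Function.Surjective f ∧
    ∀ x, Function.Surjective (tangentAt 𝒜 ℬ f x) ∧
      (tangentAt 𝒜 ℬ f x).ker.ClosedComplemented

/-- `f` exhibits `M` as a (closed, split) real analytic submanifold of `N`: it is a homeomorphism
onto its closed image, it is real analytic, and its tangent maps are all injective with (closed)
split range. -/
def IsAnalyticSubmanifold (𝒜 : AnalyticAtlas M) (ℬ : AnalyticAtlas N) (f : M → N) : Prop :=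
  Topology.IsClosedEmbedding f ∧ IsAnalyticMap 𝒜 ℬ f ∧
    ∀ x, Function.Injective (tangentAt 𝒜 ℬ f x) ∧
      (tangentAt 𝒜 ℬ f x).range.ClosedComplemented

end Maps

/-- Real analytic Banach-Lie groups. -/
def IsAnalyticBanachLieGroup {G : Type u} [Group G] [TopologicalSpace G]
    (𝒢 : AnalyticAtlas G) : Prop :=
  T2Space G ∧ IsAnalyticMap (𝒢.prod 𝒢) 𝒢 (fun p : G × G => p.1 * p.2) ∧
    IsAnalyticMap 𝒢 𝒢 (fun g : G => g⁻¹)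

/-! ## Groupoids -/

/-- A groupoid `G ⇉ M` on the set of arrows `G` with base `M`; an arrow `g` goes from `s g` to
`t g`, and `mul g h` is defined when `s g = t h`. -/
structure SetGroupoid (G : Type u) (M : Type v) where
  /-- source -/
  s : G → M
  /-- target -/
  t : G → M
  /-- partially defined multiplication -/
  mul : ∀ g h : G, s g = t h → G
  /-- identity section -/
  one : M → G
  /-- inversion -/
  inv : G → G
  s_mul : ∀ g h H, s (mul g h H) = s h
  t_mul : ∀ g h H, t (mul g h H) = t g
  mul_assoc : ∀ g h k (H : s g = t h) (K : s h = t k),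
    mul (mul g h H) k ((s_mul g h H).trans K) = mul g (mul h k K) (H.trans (t_mul h k K).symm)
  s_one : ∀ x, s (one x) = x
  t_one : ∀ x, t (one x) = x
  mul_one : ∀ g, mul g (one (s g)) (t_one (s g)).symm = g
  one_mul : ∀ g, mul (one (t g)) g (s_one (t g)) = g
  s_inv : ∀ g, s (inv g) = t g
  t_inv : ∀ g, t (inv g) = s g
  mul_inv : ∀ g, mul g (inv g) (t_inv g).symm = one (t g)
  inv_mul : ∀ g, mul (inv g) g (s_inv g) = one (s g)

namespace SetGroupoid

variable {G : Type u} {M : Type v} (Γ : SetGroupoid G M)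

/-- The set of composable pairs of arrows. -/
def Composable : Type u := {p : G × G // Γ.s p.1 = Γ.t p.2}

instance [TopologicalSpace G] : TopologicalSpace Γ.Composable :=
  inferInstanceAs (TopologicalSpace {p : G × G // Γ.s p.1 = Γ.t p.2})

/-- The multiplication as a map on the set of composable pairs. -/
def mulMap (p : Γ.Composable) : G := Γ.mul p.1.1 p.1.2 p.2

/-- The orbit of a point of the base. -/
def orbit (x : M) : Set M := Γ.t '' {g | Γ.s g = x}

/-- The isotropy group at a point of the base. -/
def Isotropy (x : M) : Type u := {g : G // Γ.s g = x ∧ Γ.t g = x}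

instance [TopologicalSpace G] (x : M) : TopologicalSpace (Γ.Isotropy x) :=
  inferInstanceAs (TopologicalSpace {g : G // Γ.s g = x ∧ Γ.t g = x})

instance (x : M) : Group (Γ.Isotropy x) where
  mul g h := ⟨Γ.mul g.1 h.1 (g.2.1.trans h.2.2.symm),
    (Γ.s_mul _ _ _).trans h.2.1, (Γ.t_mul _ _ _).trans g.2.2⟩
  one := ⟨Γ.one x, Γ.s_one x, Γ.t_one x⟩
  inv g := ⟨Γ.inv g.1, (Γ.s_inv _).trans g.2.2, (Γ.t_inv _).trans g.2.1⟩
  mul_assoc g h k := Subtype.ext (Γ.mul_assoc g.1 h.1 k.1 _ _)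
  one_mul := by
    rintro ⟨g, hs, rfl⟩
    exact Subtype.ext (Γ.one_mul g)
  mul_one := by
    rintro ⟨g, rfl, ht⟩
    exact Subtype.ext (Γ.mul_one g)
  inv_mul_cancel := by
    rintro ⟨g, rfl, ht⟩
    exact Subtype.ext (Γ.inv_mul g)

/-- Topological groupoids (the space of arrows need not be Hausdorff). -/
structure IsTopological [TopologicalSpace G] [TopologicalSpace M] : Prop where
  t2_base : T2Space M
  continuous_s : Continuous Γ.s
  surjective_s : Function.Surjective Γ.s
  isOpenMap_s : IsOpenMap Γ.s
  continuous_t : Continuous Γ.t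
  surjective_t : Function.Surjective Γ.t
  isOpenMap_t : IsOpenMap Γ.t
  continuous_mul : Continuous Γ.mulMap
  isEmbedding_one : Topology.IsEmbedding Γ.one
  isHomeomorph_inv : IsHomeomorph Γ.inv

/-- Real analytic (Hausdorff) Banach-Lie groupoids: topological groupoids whose total space and base
are Hausdorff real analytic Banach manifolds, whose source map is a submersion, and whose structure
maps are all real analytic. The multiplication is real analytic on the set of composable pairs,
regarded as a real analytic submanifold of `G × G`. -/
structure IsAnalyticBanachLie [TopologicalSpace G] [TopologicalSpace M]
    (𝒢 : AnalyticAtlas G) (ℳ : AnalyticAtlas M) : Prop where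
  isTopological : Γ.IsTopological
  t2_total : T2Space G
  submersion_s : IsAnalyticSubmersion 𝒢 ℳ Γ.s
  analytic_t : IsAnalyticMap 𝒢 ℳ Γ.t
  analytic_inv : IsAnalyticMap 𝒢 𝒢 Γ.inv
  analytic_one : IsAnalyticMap ℳ 𝒢 Γ.one
  analytic_mul : ∃ 𝒢₂ : AnalyticAtlas Γ.Composable,
    IsAnalyticSubmanifold 𝒢₂ (𝒢.prod 𝒢) (fun p => p.1) ∧ IsAnalyticMap 𝒢₂ 𝒢 Γ.mulMap

/-- Local transitivity: every orbit is open in the base. -/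
def IsLocallyTransitive [TopologicalSpace M] : Prop := ∀ x, IsOpen (Γ.orbit x)

end SetGroupoid

/-! ## The groupoid of partial isometries of a C*-algebra -/

section CStar

variable (A : Type u) [CStarAlgebra A]

/-- The set of (orthogonal) projections, with the norm topology. -/
abbrev Projections : Type u := {p : A // IsStarProjection p}

/-- The set of partial isometries, with the norm topology. -/
abbrev PartialIsometries : Type u :=
  {a : A // IsStarProjection (a * star a) ∧ IsStarProjection (star a * a)}

variable {A}

theorem mul_star_mul_self_of_isStarProjection {a : A} (h : IsStarProjection (star a * a)) :
    a * star a * a = a := by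
  have h2 : star a * a * (star a * a) = star a * a := h.isIdempotentElem
  have key : star (a * star a * a - a) * (a * star a * a - a) = 0 := by
    have e : star (a * star a * a - a) * (a * star a * a - a)
        = star a * a * (star a * a) * (star a * a) - star a * a * (star a * a)
          - star a * a * (star a * a) + star a * a := by
      simp only [star_sub, star_mul, star_star]
      noncomm_ring
    rw [e, h2, h2]
    noncomm_ring
  exact sub_eq_zero.mp (CStarRing.star_mul_self_eq_zero_iff _ |>.mp key)

variable (A)

/-- The groupoid of partial isometries over the projections: `s a = a* a`, `t a = a a*`,
multiplication from `A`, inverse `a*`, and the identity at a projection is that projection. -/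
def partialIsometryGroupoid : SetGroupoid (PartialIsometries A) (Projections A) where
  s a := ⟨star a.1 * a.1, a.2.2⟩
  t a := ⟨a.1 * star a.1, a.2.1⟩
  mul a b H := ⟨a.1 * b.1, by
    have H' : star a.1 * a.1 = b.1 * star b.1 := congrArg Subtype.val H
    have e1 : a.1 * b.1 * star (a.1 * b.1) = a.1 * star a.1 := by
      rw [star_mul]
      calc a.1 * b.1 * (star b.1 * star a.1) = a.1 * (b.1 * star b.1) * star a.1 := by
            noncomm_ring
        _ = a.1 * star a.1 * a.1 * star a.1 := by rw [← H']; noncomm_ring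
        _ = a.1 * star a.1 := by rw [mul_star_mul_self_of_isStarProjection a.2.2]
    have e2 : star (a.1 * b.1) * (a.1 * b.1) = star b.1 * b.1 := by
      rw [star_mul]
      calc star b.1 * star a.1 * (a.1 * b.1) = star b.1 * (star a.1 * a.1) * b.1 := by
            noncomm_ring
        _ = star b.1 * (b.1 * star b.1 * b.1) := by rw [H']; noncomm_ring
        _ = star b.1 * b.1 := by rw [mul_star_mul_self_of_isStarProjection b.2.2]
    rw [e1, e2]
    exact ⟨a.2.1, b.2.2⟩⟩
  one p := ⟨p.1, by
    rw [p.2.isSelfAdjoint.star_eq, p.2.isIdempotentElem.eq]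
    exact ⟨p.2, p.2⟩⟩
  inv a := ⟨star a.1, by
    rw [star_star]
    exact ⟨a.2.2, a.2.1⟩⟩
  s_mul a b H := by
    have H' : star a.1 * a.1 = b.1 * star b.1 := congrArg Subtype.val H
    apply Subtype.ext
    change star (a.1 * b.1) * (a.1 * b.1) = star b.1 * b.1
    rw [star_mul]
    calc star b.1 * star a.1 * (a.1 * b.1) = star b.1 * (star a.1 * a.1) * b.1 := by
          noncomm_ring
      _ = star b.1 * (b.1 * star b.1 * b.1) := by rw [H']; noncomm_ring
      _ = star b.1 * b.1 := by rw [mul_star_mul_self_of_isStarProjection b.2.2]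
  t_mul a b H := by
    have H' : star a.1 * a.1 = b.1 * star b.1 := congrArg Subtype.val H
    apply Subtype.ext
    change a.1 * b.1 * star (a.1 * b.1) = a.1 * star a.1
    rw [star_mul]
    calc a.1 * b.1 * (star b.1 * star a.1) = a.1 * (b.1 * star b.1) * star a.1 := by
          noncomm_ring
      _ = a.1 * star a.1 * a.1 * star a.1 := by rw [← H']; noncomm_ring
      _ = a.1 * star a.1 := by rw [mul_star_mul_self_of_isStarProjection a.2.2]
  mul_assoc a b c _ _ := Subtype.ext (mul_assoc a.1 b.1 c.1)
  s_one p := Subtype.ext (by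
    change star p.1 * p.1 = p.1
    rw [p.2.isSelfAdjoint.star_eq, p.2.isIdempotentElem.eq])
  t_one p := Subtype.ext (by
    change p.1 * star p.1 = p.1
    rw [p.2.isSelfAdjoint.star_eq, p.2.isIdempotentElem.eq])
  mul_one a := Subtype.ext (by
    change a.1 * (star a.1 * a.1) = a.1
    rw [← mul_assoc, mul_star_mul_self_of_isStarProjection a.2.2])
  one_mul a := Subtype.ext (mul_star_mul_self_of_isStarProjection a.2.2)
  s_inv a := Subtype.ext (by
    change star (star a.1) * star a.1 = a.1 * star a.1
    rw [star_star])
  t_inv a := Subtype.ext (by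
    change star a.1 * star (star a.1) = star a.1 * a.1
    rw [star_star])
  mul_inv _ := rfl
  inv_mul _ := rfl

/-- The unit of the algebra as a projection. -/
def oneProjection : Projections A := ⟨1, IsStarProjection.one A⟩

end CStar

/-! A subset of a Banach space that is near each of its points the fixed set of an analytic
retraction `r` is a split analytic submanifold: the derivative `P` of `r` is a projection, and `P`
restricts to a chart with analytic inverse (`exists_linearization_of_retraction`). So it suffices to
find local analytic retractions onto the projections, the partial isometries, the composable pairs
and the unitaries.

All of them come from one polar decomposition. For a projection `p` and `y` near a partial isometry
with source `p`, the Gram element `w = p y* y p + 1 - p` is near `1`, and `polar p y = y p w^(-1/2)`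
is a partial isometry with source `p`, analytic in `(p, y)`. The inverse square root is only an
analytic germ at `1`; uniqueness of the solution of a Sylvester equation makes it self-adjoint and
compatible with `p` (`star_polar_mul_polar`). For nearby projections `p` and `q`, `polar p q` is an
arrow from `p` to `q`, because nested projections at distance less than `1` agree. Such arrows give
the sections of the source map, the retraction onto composable pairs and the open orbits.

The charts are restrictions of continuous linear maps (`Realizes`). Maps between these manifolds are
therefore analytic once they extend locally to analytic maps of the ambient spaces, and each
structure map is a polynomial in its arguments and their adjoints. Split tangent maps follow from
one-sided inverses: the charts supply left inverses for inclusions, and local sections supply right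
inverses for the source map. -/

open Filter Topology

/-! ### Analytic inverse functions and the linearization of retractions -/

section InverseFunction

variable {E : Type u} [NormedAddCommGroup E] [NormedSpace ℝ E] [CompleteSpace E]

/-- The real analytic inverse function theorem. -/
theorem AnalyticAt.exists_local_inverse {f : E → E} {x : E} (hf : AnalyticAt ℝ f x)
    (e : E ≃L[ℝ] E) (he : HasFDerivAt f (e : E →L[ℝ] E) x) :
    ∃ g : E → E, AnalyticAt ℝ g (f x) ∧ HasFDerivAt g (e.symm : E →L[ℝ] E) (f x) ∧ g (f x) = x ∧
      (∀ᶠ y in 𝓝 x, g (f y) = y) ∧ ∀ᶠ z in 𝓝 (f x), f (g z) = z := by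
  have hs : HasStrictFDerivAt f (e : E →L[ℝ] E) x := by
    have := hf.hasStrictFDerivAt
    rwa [he.fderiv] at this
  refine ⟨hs.localInverse f e x, ?_, hs.to_localInverse.hasFDerivAt, hs.localInverse_apply_image,
    hs.eventually_left_inverse, hs.eventually_right_inverse⟩
  obtain ⟨p, hp⟩ := hf
  refine ((hs.toOpenPartialHomeomorph f).hasFPowerSeriesAt_symm (i := e)
    hs.mem_toOpenPartialHomeomorph_source hp ?_).analyticAt
  rw [← he.fderiv, hp.fderiv_eq]
  ext v
  simp

/-- Near a fixed point, a local analytic retraction `r` onto a set `S` is straightened by its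
derivative `P`: the projection `P` restricts to a chart of `S` with analytic inverse. -/
theorem exists_linearization_of_retraction {S : Set E} {x : E} {r : E → E}
    (hr : AnalyticAt ℝ r x) (hrx : r x = x) (hS : ∀ᶠ y in 𝓝 x, r y ∈ S)
    (hfix : ∀ᶠ y in 𝓝 x, y ∈ S → r y = y) :
    ∃ (P : E →L[ℝ] E) (ψ : E → E) (W O : Set E), (∀ v, P (P v) = P v) ∧ IsOpen W ∧ IsOpen O ∧
      x ∈ W ∧ AnalyticOnNhd ℝ ψ O ∧ HasFDerivAt ψ P (P x) ∧
      (∀ y ∈ W, y ∈ S → P y ∈ O ∧ ψ (P y) = y) ∧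
      ∀ v ∈ O, P v = v → ψ v ∈ S ∧ ψ v ∈ W ∧ P (ψ v) = v := by
  set P := fderiv ℝ r x
  have hD : HasFDerivAt r P x := hr.differentiableAt.hasFDerivAt
  have htend : Tendsto r (𝓝 x) (𝓝 x) := by
    simpa only [ContinuousAt, hrx] using hr.continuousAt
  have hrr : ∀ᶠ y in 𝓝 x, r (r y) = r y := by
    filter_upwards [hS, htend.eventually hfix] with y h1 h2 using h2 h1
  -- Differentiate `r ∘ r = r` at the fixed point `x`.
  have hPP : ∀ v, P (P v) = P v := by
    have h1 : HasFDerivAt (fun y => r (r y)) (P.comp P) x :=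
      HasFDerivAt.comp x (by rwa [hrx]) hD
    have h2 : P.comp P = P := (h1.congr_of_eventuallyEq (EventuallyEq.symm hrr)).unique hD
    exact fun v => DFunLike.congr_fun h2 v
  -- This is `(1 - P)(y - r y) + P (r y)`. Its derivative at `x` is `(1 - P)² + P² = 1`, and on
  -- points fixed by `r` it equals `P`. Hence `Φ` is a local diffeomorphism straightening `S` onto
  -- the range of `P`.
  let Φ : E → E := fun y => y - r y - P y + (2 : ℝ) • P (r y)
  have hΦa : AnalyticAt ℝ Φ x :=
    ((analyticAt_id.fun_sub hr).fun_sub (P.analyticAt x)).fun_add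
      (((P.analyticAt _).fun_comp hr).fun_const_smul)
  have hΦx : Φ x = P x := by simp only [Φ, hrx, two_smul]; abel
  have hΦd : HasFDerivAt Φ ((ContinuousLinearEquiv.refl ℝ E : E ≃L[ℝ] E) : E →L[ℝ] E) x := by
    have := (((hasFDerivAt_id x).fun_sub hD).fun_sub P.hasFDerivAt).fun_add
      ((P.hasFDerivAt.comp x hD).fun_const_smul (2 : ℝ))
    refine this.congr_fderiv ?_
    ext v
    simp only [add_apply, sub_apply, ContinuousLinearMap.comp_apply, hPP,
      ContinuousLinearMap.id_apply, two_smul, ContinuousLinearEquiv.coe_coe,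
      ContinuousLinearEquiv.refl_apply]
    abel
  obtain ⟨g, hga, hgd, hgx, hgf, hfg⟩ := hΦa.exists_local_inverse _ hΦd
  rw [hΦx] at hga hgd hgx hfg
  have hgt : Tendsto g (𝓝 (P x)) (𝓝 x) := by
    simpa only [ContinuousAt, hgx] using hga.continuousAt
  have hψa : AnalyticAt ℝ (fun v => r (g v)) (P x) := AnalyticAt.fun_comp (by rwa [hgx]) hga
  obtain ⟨O₀, hO₀, hO₀o, hO₀x⟩ := eventually_nhds_iff.1
    (hψa.eventually_analyticAt.and ((hgt.eventually hS).and hfg))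
  obtain ⟨W₀, hW₀, hW₀o, hW₀x⟩ := eventually_nhds_iff.1 (hgf.and hfix)
  have hψc : ContinuousOn (fun v => r (g v)) O₀ := fun v hv =>
    (hO₀ v hv).1.continuousAt.continuousWithinAt
  have hψP : ∀ y ∈ W₀, y ∈ S → r (g (P y)) = y := by
    intro y hy hyS
    have h1 : Φ y = P y := by simp only [Φ, (hW₀ y hy).2 hyS, two_smul]; abel
    rw [← h1, (hW₀ y hy).1, (hW₀ y hy).2 hyS]
  have hPψ : ∀ v ∈ O₀, P v = v → P (r (g v)) = v := by
    intro v hv hvP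
    -- `P` kills the `(1 - P)` part of `Φ (g v) = v`, leaving `P (r (g v)) = P v`.
    have h1 := congrArg P (hO₀ v hv).2.2
    simp only [Φ, map_add, map_sub, hPP, two_smul] at h1
    have h2 : P (r (g v)) = P (g v) - P (r (g v)) - P (g v) + (P (r (g v)) + P (r (g v))) := by
      abel
    exact h2.trans (h1.trans hvP)
  refine ⟨P, fun v => r (g v), W₀ ∩ P ⁻¹' O₀, O₀ ∩ (fun v => r (g v)) ⁻¹' W₀, hPP,
    hW₀o.inter (hO₀o.preimage P.continuous), hψc.isOpen_inter_preimage hO₀o hW₀o,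
    ⟨hW₀x, hO₀x⟩, fun v hv => (hO₀ v hv.1).1, ?_, ?_, ?_⟩
  · exact HasFDerivAt.comp (P x) (g := r) (g' := P) (by rwa [hgx]) hgd
  · rintro y ⟨hy, hyO⟩ hyS
    have := hψP y hy hyS
    exact ⟨⟨hyO, by rwa [Set.mem_preimage, this]⟩, this⟩
  · rintro v ⟨hv, hvW⟩ hvP
    have := hPψ v hv hvP
    exact ⟨(hO₀ v hv).2.1, ⟨hvW, by rwa [Set.mem_preimage, this]⟩, this⟩

end InverseFunction

/-! ### Analyticity and tangent maps through ambient extensions -/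

section Realizes

variable {M : Type u} {N : Type u} [TopologicalSpace M] [TopologicalSpace N]
  {E : Type u} [NormedAddCommGroup E] [NormedSpace ℝ E]
  {F : Type u} [NormedAddCommGroup F] [NormedSpace ℝ F]

/-- The topological embedding `ι` of `M` into a Banach space realizes the atlas `𝒜` if, around each
point, the chart of `𝒜` is the restriction of a continuous linear map `c`, and the inverse of the
chart is analytic into the Banach space, with a derivative split by `c`. -/
structure Realizes (𝒜 : AnalyticAtlas M) (ι : M → E) : Prop where
  isEmbedding : IsEmbedding ι
  exists_chart : ∀ x, ∃ (c : E →L[ℝ] 𝒜.Model x) (i : 𝒜.Model x →L[ℝ] E),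
    (∀ v, c (i v) = v) ∧ (∀ᶠ y in 𝓝 x, 𝒜.chart x y = c (ι y)) ∧
    AnalyticAt ℝ (fun v => ι ((𝒜.chart x).symm v)) (𝒜.chart x x) ∧
    HasFDerivAt (fun v => ι ((𝒜.chart x).symm v)) i (𝒜.chart x x)

theorem Realizes.ofBanach [CompleteSpace E] :
    Realizes (AnalyticAtlas.ofBanach E) (fun x : E => x) where
  isEmbedding := IsEmbedding.id
  exists_chart _ := ⟨ContinuousLinearMap.id ℝ E, ContinuousLinearMap.id ℝ E, fun _ => rfl,
    Eventually.of_forall fun _ => rfl, analyticAt_id, hasFDerivAt_id _⟩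

theorem Realizes.prod {𝒜 : AnalyticAtlas M} {ℬ : AnalyticAtlas N} {ι : M → E} {κ : N → F}
    (h : Realizes 𝒜 ι) (k : Realizes ℬ κ) :
    Realizes (𝒜.prod ℬ) (fun x : M × N => (ι x.1, κ x.2)) where
  isEmbedding := h.isEmbedding.prodMap k.isEmbedding
  exists_chart x := by
    obtain ⟨c, i, hci, hc, ha, hd⟩ := h.exists_chart x.1
    obtain ⟨c', i', hci', hc', ha', hd'⟩ := k.exists_chart x.2
    refine ⟨c.prodMap c', i.prodMap i', fun v => Prod.ext (hci v.1) (hci' v.2), ?_, ?_, ?_⟩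
    · filter_upwards [continuousAt_fst.eventually hc, continuousAt_snd.eventually hc'] with y h1 h2
      exact Prod.ext h1 h2
    · exact (ha.fun_comp_of_eq analyticAt_fst rfl).prod (ha'.fun_comp_of_eq analyticAt_snd rfl)
    · exact HasFDerivAt.prodMap (p := (𝒜.chart x.1 x.1, ℬ.chart x.2 x.2)) hd hd'

variable {𝒜 : AnalyticAtlas M} {ℬ : AnalyticAtlas N} {ι : M → E} {κ : N → F}

/-- A map that extends near `x` to an analytic map of the ambient Banach spaces is analytic at `x`,
and its tangent map is induced by the derivative of the extension. -/
theorem Realizes.analyticAt_chartExpr (h : Realizes 𝒜 ι) (k : Realizes ℬ κ) {f : M → N} {x : M}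
    {φ : E → F} (hφ : AnalyticAt ℝ φ (ι x)) (hf : ∀ᶠ y in 𝓝 x, κ (f y) = φ (ι y)) :
    ContinuousAt f x ∧ AnalyticAt ℝ (chartExpr 𝒜 ℬ f x) (𝒜.chart x x) ∧
      HasFDerivAt (chartExpr 𝒜 ℬ f x) (tangentAt 𝒜 ℬ f x) (𝒜.chart x x) := by
  obtain ⟨c, i, hci, hc, ha, hd⟩ := h.exists_chart x
  obtain ⟨c', i', hci', hc', ha', hd'⟩ := k.exists_chart (f x)
  have hfc : ContinuousAt f x := by
    rw [k.isEmbedding.continuousAt_iff]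
    exact (hφ.continuousAt.comp (f := ι) h.isEmbedding.continuous.continuousAt).congr
      (EventuallyEq.symm hf)
  have hx : (𝒜.chart x).symm (𝒜.chart x x) = x := (𝒜.chart x).left_inv (𝒜.mem_source x)
  have hs : Tendsto (𝒜.chart x).symm (𝓝 (𝒜.chart x x)) (𝓝 x) := by
    have := (𝒜.chart x).continuousAt_symm ((𝒜.chart x).map_source (𝒜.mem_source x))
    rwa [ContinuousAt, hx] at this
  have he : (fun v => c' (φ (ι ((𝒜.chart x).symm v)))) =ᶠ[𝓝 (𝒜.chart x x)]
      chartExpr 𝒜 ℬ f x := by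
    filter_upwards [hs.eventually hf, (hfc.tendsto.comp hs).eventually hc'] with v h1 h2
    exact ((h2 : ℬ.chart (f x) (f ((𝒜.chart x).symm v)) = _).trans (congrArg c' h1)).symm
  have hA : AnalyticAt ℝ (chartExpr 𝒜 ℬ f x) (𝒜.chart x x) :=
    ((c'.analyticAt _).fun_comp (hφ.fun_comp_of_eq ha (by rw [hx]))).congr he
  exact ⟨hfc, hA, hA.differentiableAt.hasFDerivAt⟩

theorem Realizes.isAnalyticMap (h : Realizes 𝒜 ι) (k : Realizes ℬ κ) {f : M → N}
    (H : ∀ x, ∃ φ : E → F, AnalyticAt ℝ φ (ι x) ∧ ∀ᶠ y in 𝓝 x, κ (f y) = φ (ι y)) :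
    IsAnalyticMap 𝒜 ℬ f := by
  refine ⟨continuous_iff_continuousAt.2 fun x => ?_, fun x => ?_⟩ <;>
  obtain ⟨φ, hφ, hf⟩ := H x
  exacts [(h.analyticAt_chartExpr k hφ hf).1, (h.analyticAt_chartExpr k hφ hf).2.1]

/-- The ambient expression `i'` of the tangent vectors intertwines the tangent map with the
derivative of an extension to the ambient spaces. -/
theorem Realizes.tangentAt_apply (h : Realizes 𝒜 ι) (k : Realizes ℬ κ) {f : M → N} {x : M}
    {φ : E → F} (hφ : AnalyticAt ℝ φ (ι x)) (hf : ∀ᶠ y in 𝓝 x, κ (f y) = φ (ι y))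
    {i : 𝒜.Model x →L[ℝ] E} {i' : ℬ.Model (f x) →L[ℝ] F}
    (hi : HasFDerivAt (fun v => ι ((𝒜.chart x).symm v)) i (𝒜.chart x x))
    (hi' : HasFDerivAt (fun v => κ ((ℬ.chart (f x)).symm v)) i' (ℬ.chart (f x) (f x)))
    (v : 𝒜.Model x) :
    i' (tangentAt 𝒜 ℬ f x v) = fderiv ℝ φ (ι x) (i v) := by
  obtain ⟨hfc, -, hT⟩ := h.analyticAt_chartExpr k hφ hf
  have hx : (𝒜.chart x).symm (𝒜.chart x x) = x := (𝒜.chart x).left_inv (𝒜.mem_source x)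
  have hs : Tendsto (𝒜.chart x).symm (𝓝 (𝒜.chart x x)) (𝓝 x) := by
    have := (𝒜.chart x).continuousAt_symm ((𝒜.chart x).map_source (𝒜.mem_source x))
    rwa [ContinuousAt, hx] at this
  have hex : chartExpr 𝒜 ℬ f x (𝒜.chart x x) = ℬ.chart (f x) (f x) := by
    rw [chartExpr, hx]
  have h1 : HasFDerivAt (fun v => κ ((ℬ.chart (f x)).symm (chartExpr 𝒜 ℬ f x v)))
      (i'.comp (tangentAt 𝒜 ℬ f x)) (𝒜.chart x x) :=
    HasFDerivAt.comp (𝒜.chart x x) (g := fun v => κ ((ℬ.chart (f x)).symm v)) (by rwa [hex]) hT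
  have h2 : HasFDerivAt (fun v => φ (ι ((𝒜.chart x).symm v)))
      ((fderiv ℝ φ (ι x)).comp i) (𝒜.chart x x) :=
    HasFDerivAt.comp (𝒜.chart x x) (g := φ)
      (by rw [hx]; exact hφ.differentiableAt.hasFDerivAt) hi
  have he : (fun v => φ (ι ((𝒜.chart x).symm v))) =ᶠ[𝓝 (𝒜.chart x x)]
      fun v => κ ((ℬ.chart (f x)).symm (chartExpr 𝒜 ℬ f x v)) := by
    filter_upwards [hs.eventually hf, (hfc.tendsto.comp hs).eventually
      ((ℬ.chart (f x)).open_source.mem_nhds (ℬ.mem_source (f x)))] with v h1 h2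
    exact h1.symm.trans (congrArg κ ((ℬ.chart (f x)).left_inv h2).symm)
  exact DFunLike.congr_fun (h1.unique (h2.congr_of_eventuallyEq he.symm)) v

/-- Both manifolds sit in the same Banach space and `f` extends to the identity there, so a tangent
vector and its image have the same ambient expression. The linear chart `c` of `M` recovers the
vector from it, giving the left inverse `c ∘ i'` of the tangent map. -/
theorem Realizes.isAnalyticSubmanifold {f : M → N} {κ : N → E} (k : Realizes ℬ κ)
    (h : Realizes 𝒜 (fun x => κ (f x))) (hf : IsClosedEmbedding f) :
    IsAnalyticSubmanifold 𝒜 ℬ f := by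
  refine ⟨hf, h.isAnalyticMap k fun x => ⟨id, analyticAt_id, Eventually.of_forall fun _ => rfl⟩,
    fun x => ?_⟩
  obtain ⟨c, i, hci, -, -, hd⟩ := h.exists_chart x
  obtain ⟨c', i', -, -, -, hd'⟩ := k.exists_chart (f x)
  have key : Function.LeftInverse (c.comp i') (tangentAt 𝒜 ℬ f x) := fun v => by
    have := h.tangentAt_apply k (φ := id) analyticAt_id (Eventually.of_forall fun _ => rfl) hd hd' v
    rw [ContinuousLinearMap.comp_apply, this, fderiv_id]
    exact hci v
  exact ⟨key.injective, ContinuousLinearMap.closedComplemented_range_of_leftInverse _ _ key⟩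

/-- A local section `σ` through every point, with analytic ambient extension `τ`, differentiates to
a right inverse of the tangent map. That gives both surjectivity and a complement of the kernel. -/
theorem Realizes.isAnalyticSubmersion {f : M → N} (h : Realizes 𝒜 ι) (k : Realizes ℬ κ)
    (hf : Function.Surjective f)
    (H : ∀ x, ∃ φ : E → F, AnalyticAt ℝ φ (ι x) ∧ ∀ᶠ y in 𝓝 x, κ (f y) = φ (ι y))
    (hσ : ∀ x, ∃ (σ : N → M) (τ : F → E), σ (f x) = x ∧ (∀ᶠ y in 𝓝 (f x), f (σ y) = y) ∧
      AnalyticAt ℝ τ (κ (f x)) ∧ ∀ᶠ y in 𝓝 (f x), ι (σ y) = τ (κ y)) :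
    IsAnalyticSubmersion 𝒜 ℬ f := by
  refine ⟨h.isAnalyticMap k H, hf, fun x => ?_⟩
  obtain ⟨φ, hφ, hfφ⟩ := H x
  obtain ⟨σ, τ, hσx, hfσ, hτ, hστ⟩ := hσ x
  have hc := (k.analyticAt_chartExpr h hτ hστ).1
  obtain ⟨c, i, hci, hcx, -, hd⟩ := h.exists_chart x
  obtain ⟨c', i', hci', -, -, hd'⟩ := k.exists_chart (f x)
  have hιx : τ (κ (f x)) = ι x := by rw [← hστ.self_of_nhds, hσx]
  have hσt : Tendsto σ (𝓝 (f x)) (𝓝 x) := by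
    have := (k.analyticAt_chartExpr h hτ hστ).1.tendsto
    rwa [hσx] at this
  have hx : (ℬ.chart (f x)).symm (ℬ.chart (f x) (f x)) = f x :=
    (ℬ.chart (f x)).left_inv (ℬ.mem_source (f x))
  have hs : Tendsto (ℬ.chart (f x)).symm (𝓝 (ℬ.chart (f x) (f x))) (𝓝 (f x)) := by
    have := (ℬ.chart (f x)).continuousAt_symm ((ℬ.chart (f x)).map_source (ℬ.mem_source (f x)))
    rwa [ContinuousAt, hx] at this
  set z := ℬ.chart (f x) (f x)
  let g : ℬ.Model (f x) → E := fun v => τ (κ ((ℬ.chart (f x)).symm v))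
  have hgz : g z = ι x := by simp only [g, hx, hιx]
  have hg : HasFDerivAt g ((fderiv ℝ τ (κ (f x))).comp i') z :=
    HasFDerivAt.comp z (g := τ) (by rw [hx]; exact hτ.differentiableAt.hasFDerivAt) hd'
  have hcz : c (ι x) = 𝒜.chart x x := hcx.self_of_nhds.symm
  have h1 : HasFDerivAt (fun v => ι ((𝒜.chart x).symm (c (g v))))
      (i.comp (c.comp ((fderiv ℝ τ (κ (f x))).comp i'))) z :=
    HasFDerivAt.comp z (g := fun w => ι ((𝒜.chart x).symm w)) (by rwa [hgz, hcz])
      (c.hasFDerivAt.comp z hg)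
  -- Near `z` the map `g` takes values in the image of `M`, where the inverse chart undoes `c`.
  -- Hence `i ∘ c` fixes the derivative of `g`.
  have e1 : (fun v => ι ((𝒜.chart x).symm (c (g v)))) =ᶠ[𝓝 z] g := by
    filter_upwards [hs.eventually hστ, (hσt.comp hs).eventually hcx, (hσt.comp hs).eventually
      ((𝒜.chart x).open_source.mem_nhds (𝒜.mem_source x))] with v h1 h2 h3
    have h2' : 𝒜.chart x (σ ((ℬ.chart (f x)).symm v)) = c (ι (σ ((ℬ.chart (f x)).symm v))) := h2
    simp only [g]
    rw [← h1, ← h2']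
    exact congrArg ι ((𝒜.chart x).left_inv h3)
  have h2 : HasFDerivAt (fun v => φ (g v))
      ((fderiv ℝ φ (ι x)).comp ((fderiv ℝ τ (κ (f x))).comp i')) z :=
    HasFDerivAt.comp z (g := φ) (by rw [hgz]; exact hφ.differentiableAt.hasFDerivAt) hg
  -- The ambient form of `f ∘ σ = id`: differentiated, `Dφ ∘ Dτ` fixes the range of `i'`.
  have e2 : (fun v => φ (g v)) =ᶠ[𝓝 z] fun v => κ ((ℬ.chart (f x)).symm v) := by
    filter_upwards [hs.eventually hστ, hs.eventually hfσ, (hσt.comp hs).eventually hfφ]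
      with v h1 h2 h3
    have h3' : κ (f (σ ((ℬ.chart (f x)).symm v))) = φ (ι (σ ((ℬ.chart (f x)).symm v))) := h3
    simp only [g]
    rw [← h1, ← h3', h2]
  have key : Function.RightInverse (c.comp ((fderiv ℝ τ (κ (f x))).comp i'))
      (tangentAt 𝒜 ℬ f x) := fun v => by
    have a1 := DFunLike.congr_fun (h1.unique (hg.congr_of_eventuallyEq e1)) v
    have a2 := DFunLike.congr_fun (h2.unique (hd'.congr_of_eventuallyEq e2)) v
    have a3 := h.tangentAt_apply k hφ hfφ hd hd' (c (fderiv ℝ τ (κ (f x)) (i' v)))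
    simp only [ContinuousLinearMap.comp_apply] at a1 a2 a3 ⊢
    rw [a1, a2] at a3
    rw [← hci' (tangentAt 𝒜 ℬ f x _), a3, hci']
  exact ⟨key.surjective, ContinuousLinearMap.closedComplemented_ker_of_rightInverse _ _ key⟩

end Realizes

set_option linter.unusedSectionVars false

/-! ### The atlas of a local analytic retract -/

section Retract

variable {M : Type u} [TopologicalSpace M]
  {E : Type u} [NormedAddCommGroup E] [NormedSpace ℝ E] [CompleteSpace E]

/-- The range of the topological embedding `ι` is locally an analytic retract. -/
structure IsAnalyticRetract (ι : M → E) : Prop where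
  isEmbedding : IsEmbedding ι
  exists_retraction : ∀ x, ∃ r : E → E, AnalyticAt ℝ r (ι x) ∧
    (∀ᶠ y in 𝓝 (ι x), r y ∈ Set.range ι) ∧ ∀ᶠ m in 𝓝 x, r (ι m) = ι m

/-- A linear chart around `x` for the range of `ι`: a continuous projection `P` that is injective
on the range of `ι` near `ι x`, with analytic inverse `ψ`. -/
structure LinearChart (ι : M → E) (x : M) where
  P : E →L[ℝ] E
  ψ : E → E
  W : Set E
  O : Set E
  idem : ∀ v, P (P v) = P v
  isOpen_W : IsOpen W
  isOpen_O : IsOpen O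
  mem_W : ι x ∈ W
  analyticOn : AnalyticOnNhd ℝ ψ O
  hasFDerivAt : HasFDerivAt ψ P (P (ι x))
  left_inv : ∀ m, ι m ∈ W → P (ι m) ∈ O ∧ ψ (P (ι m)) = ι m
  right_inv : ∀ v ∈ O, P v = v → ψ v ∈ Set.range ι ∧ ψ v ∈ W ∧ P (ψ v) = v

theorem IsAnalyticRetract.nonempty_linearChart {ι : M → E} (h : IsAnalyticRetract ι) (x : M) :
    Nonempty (LinearChart ι x) := by
  obtain ⟨r, hr, hS, hfix⟩ := h.exists_retraction x
  -- Since `ι` is inducing, a neighbourhood of `x` in `M` is cut out by one of `ι x` in `E`.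
  have hfix' : ∀ᶠ y in 𝓝 (ι x), y ∈ Set.range ι → r y = y := by
    rw [h.isEmbedding.isInducing.nhds_eq_comap, eventually_comap] at hfix
    filter_upwards [hfix] with y hy
    rintro ⟨m, rfl⟩
    exact hy m rfl
  obtain ⟨P, ψ, W, O, h1, h2, h3, h4, h5, h6, h7, h8⟩ :=
    exists_linearization_of_retraction hr hfix.self_of_nhds hS hfix'
  exact ⟨⟨P, ψ, W, O, h1, h2, h3, h4, h5, h6, fun m hm => h7 _ hm ⟨m, rfl⟩, h8⟩⟩

namespace LinearChart

variable {ι : M → E} {x : M} (C : LinearChart ι x)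

/-- The model space of a linear chart: the range of the projection. -/
abbrev Model : Type u := (ContinuousLinearMap.id ℝ E - C.P).ker

theorem P_coe (v : C.Model) : C.P v = v := by
  have := v.2
  rw [LinearMap.mem_ker] at this
  exact (sub_eq_zero.1 this).symm

/-- The projection onto the model space. -/
def proj : E →L[ℝ] C.Model :=
  C.P.codRestrict _ fun v => by
    rw [LinearMap.mem_ker]
    exact sub_eq_zero.2 (C.idem v).symm

@[simp] theorem coe_proj (v : E) : (C.proj v : E) = C.P v := rfl

theorem proj_coe (v : C.Model) : C.proj v = v := Subtype.ext (C.P_coe v)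

/-- The inverse of the projection, as a map into `M`. -/
noncomputable def inv (v : C.Model) : M :=
  -- The point `x` only witnesses nonemptiness; the values off `C.O` play no role.
  @Function.invFun _ _ ⟨x⟩ ι (C.ψ v)

theorem ι_inv {v : C.Model} (hv : (v : E) ∈ C.O) : ι (C.inv v) = C.ψ v :=
  @Function.invFun_eq _ _ ⟨x⟩ _ _ (C.right_inv v hv (C.P_coe v)).1

/-- The chart of `M` defined by a linear chart of the range of `ι`. -/
noncomputable def toOpenPartialHomeomorph (hι : IsEmbedding ι) :
    OpenPartialHomeomorph M C.Model where
  toFun m := C.proj (ι m)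
  invFun := C.inv
  source := ι ⁻¹' C.W
  target := (fun v : C.Model => (v : E)) ⁻¹' C.O
  map_source' m hm := (C.left_inv m hm).1
  map_target' v hv := by
    rw [Set.mem_preimage, C.ι_inv hv]
    exact (C.right_inv v hv (C.P_coe v)).2.1
  left_inv' m hm := hι.injective <| by
    rw [C.ι_inv (C.left_inv m hm).1]
    exact (C.left_inv m hm).2
  right_inv' v hv := Subtype.ext <| by
    rw [coe_proj, C.ι_inv hv]
    exact (C.right_inv v hv (C.P_coe v)).2.2
  open_source := C.isOpen_W.preimage hι.continuous
  open_target := C.isOpen_O.preimage continuous_subtype_val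
  continuousOn_toFun := (C.proj.continuous.comp hι.continuous).continuousOn
  continuousOn_invFun := by
    rw [hι.isInducing.continuousOn_iff]
    refine ContinuousOn.congr (f := fun v : C.Model => C.ψ v) ?_ fun v hv => C.ι_inv hv
    exact C.analyticOn.continuousOn.comp continuous_subtype_val.continuousOn fun _ h => h

end LinearChart

/-- The analytic atlas on a topological space embedded as a local analytic retract of a
Banach space. -/
noncomputable def IsAnalyticRetract.atlas {ι : M → E} (h : IsAnalyticRetract ι) :
    AnalyticAtlas M where
  Model x := (h.nonempty_linearChart x).some.Model
  chart x := (h.nonempty_linearChart x).some.toOpenPartialHomeomorph h.isEmbedding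
  mem_source x := (h.nonempty_linearChart x).some.mem_W
  analyticOn_transition x y v hv := by
    let C := (h.nonempty_linearChart x).some
    let D := (h.nonempty_linearChart y).some
    let w₀ : C.Model := v
    have hv' : (w₀ : E) ∈ C.O := hv.1
    change AnalyticAt ℝ (fun w : C.Model => D.proj (ι (C.inv w))) w₀
    refine AnalyticAt.congr (f := fun w : C.Model => D.proj (C.ψ w)) ?_ ?_
    · exact (D.proj.analyticAt _).fun_comp
        ((C.analyticOn _ hv').fun_comp ((Submodule.subtypeL _).analyticAt w₀))
    · filter_upwards [(C.isOpen_O.preimage continuous_subtype_val).mem_nhds hv'] with w hw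
      exact congrArg D.proj (C.ι_inv hw).symm

theorem IsAnalyticRetract.realizes {ι : M → E} (h : IsAnalyticRetract ι) :
    Realizes h.atlas ι where
  isEmbedding := h.isEmbedding
  exists_chart x := by
    let C := (h.nonempty_linearChart x).some
    have hx : C.P (ι x) ∈ C.O := (C.left_inv x C.mem_W).1
    have he : (fun v : C.Model => C.ψ v) =ᶠ[𝓝 (C.proj (ι x))] fun v => ι (C.inv v) := by
      filter_upwards [(C.isOpen_O.preimage continuous_subtype_val).mem_nhds
        (show C.proj (ι x) ∈ _ from hx)] with w hw
      exact (C.ι_inv hw).symm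
    refine ⟨C.proj, Submodule.subtypeL _, C.proj_coe, Eventually.of_forall fun _ => rfl, ?_, ?_⟩
    · have h1 : AnalyticAt ℝ (fun v : C.Model => C.ψ v) (C.proj (ι x)) :=
        
          AnalyticAt.fun_comp (C.analyticOn _ hx)
          ((Submodule.subtypeL (ContinuousLinearMap.id ℝ E - C.P).ker).analyticAt _)
      exact h1.congr he
    · have h1 : HasFDerivAt (fun v : C.Model => C.ψ v) (C.P.comp (Submodule.subtypeL _))
          (C.proj (ι x)) :=
        HasFDerivAt.comp (C.proj (ι x)) (g := C.ψ) C.hasFDerivAt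
          (Submodule.subtypeL _).hasFDerivAt
      refine (h1.congr_of_eventuallyEq he.symm).congr_fderiv ?_
      ext v
      exact C.P_coe v

end Retract

/-! ### An analytic inverse square root near the unit -/

section InvSqrt

variable {A : Type u} [NormedRing A] [NormedAlgebra ℝ A]

/-- The Sylvester equation `x c + c y = 0` has only the trivial solution if `x`, `y` are close
to `1`. -/
theorem eq_zero_of_mul_add_mul_eq_zero {x y c : A} (h : x * c + c * y = 0) (hx : ‖x - 1‖ < 1)
    (hy : ‖y - 1‖ < 1) : c = 0 := by
  by_contra hc
  have hc' : 0 < ‖c‖ := norm_pos_iff.2 hc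
  have e : (2 : ℝ) • c = -((x - 1) * c + c * (y - 1)) := by
    rw [two_smul, sub_mul, mul_sub, one_mul, mul_one, ← sub_eq_zero, ← h]
    abel
  have h1 : 2 * ‖c‖ ≤ ‖x - 1‖ * ‖c‖ + ‖c‖ * ‖y - 1‖ := by
    calc 2 * ‖c‖ = ‖(2 : ℝ) • c‖ := by rw [norm_smul]; norm_num
      _ ≤ ‖(x - 1) * c‖ + ‖c * (y - 1)‖ := by rw [e, norm_neg]; exact norm_add_le _ _
      _ ≤ _ := add_le_add (norm_mul_le _ _) (norm_mul_le _ _)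
  nlinarith

/-- Squaring is a local analytic diffeomorphism at `1`; `t` is its local inverse composed with
inversion in the algebra. No functional calculus is involved. -/
theorem exists_analytic_invSqrt (A : Type u) [NormedRing A] [NormedAlgebra ℝ A] [CompleteSpace A] :
    ∃ t : A → A, AnalyticAt ℝ t 1 ∧ t 1 = 1 ∧
      ∀ᶠ x in 𝓝 1, t x * t x * x = 1 ∧ x * (t x * t x) = 1 := by
  -- The factor one half makes the derivative at `1` the identity.
  let f : A → A := fun x => (2⁻¹ : ℝ) • (x * x)
  have hf : AnalyticAt ℝ f 1 := (analyticAt_id.fun_mul analyticAt_id).fun_const_smul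
  have hd : HasFDerivAt f ((ContinuousLinearEquiv.refl ℝ A : A ≃L[ℝ] A) : A →L[ℝ] A) 1 := by
    refine (((hasFDerivAt_id (1 : A)).fun_mul' (hasFDerivAt_id 1)).fun_const_smul
      (2⁻¹ : ℝ)).congr_fderiv ?_
    ext v
    simp
    rw [← add_smul]
    norm_num
  obtain ⟨g, hga, -, hg1, -, hfg⟩ := hf.exists_local_inverse _ hd
  have hf1 : (2⁻¹ : ℝ) • (1 : A) = f 1 := by simp [f]
  have hi : AnalyticAt ℝ Ring.inverse (1 : A) := analyticAt_inverse (𝕜 := ℝ) (1 : Aˣ)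
  have hi1 : (2⁻¹ : ℝ) • Ring.inverse (1 : A) = f 1 := by rw [Ring.inverse_one, hf1]
  have hj : AnalyticAt ℝ (fun x : A => (2⁻¹ : ℝ) • Ring.inverse x) 1 := hi.fun_const_smul
  refine ⟨fun x => g ((2⁻¹ : ℝ) • Ring.inverse x), AnalyticAt.fun_comp (by rwa [hi1]) hj,
    (congrArg g hi1).trans hg1, ?_⟩
  have hu : ∀ᶠ x : A in 𝓝 1, IsUnit x :=
    Units.isOpen.mem_nhds isUnit_one
  have ht := hj.continuousAt.tendsto
  rw [hi1] at ht
  filter_upwards [hu, ht.eventually hfg] with x hx h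
  have h' := smul_right_injective A (inv_ne_zero (two_ne_zero (α := ℝ))) h
  rw [h']
  exact ⟨Ring.inverse_mul_cancel _ hx, Ring.mul_inverse_cancel _ hx⟩

end InvSqrt

/-! ### Polar decomposition relative to a projection -/

section Polar

variable {A : Type u} [CStarAlgebra A]

theorem analyticAt_star (a : A) : AnalyticAt ℝ (star : A → A) a :=
  (starL' ℝ : A ≃L[ℝ] A).toContinuousLinearMap.analyticAt a

theorem AnalyticAt.fun_star {E : Type v} [NormedAddCommGroup E] [NormedSpace ℝ E] {f : E → A}
    {x : E} (hf : AnalyticAt ℝ f x) : AnalyticAt ℝ (fun y => star (f y)) x :=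
  (analyticAt_star _).fun_comp hf

/-- As `f ≤ e`, the difference `e - f` is itself a projection, so its norm equals its own square
and, being less than `1`, vanishes. -/
theorem eq_of_mul_eq_of_norm_sub_lt_one {e f : A} (he : IsStarProjection e)
    (hf : IsStarProjection f) (hef : e * f = f) (h : ‖e - f‖ < 1) : e = f := by
  have hfe : f * e = f := by
    have := congrArg star hef
    rwa [star_mul, he.isSelfAdjoint.star_eq, hf.isSelfAdjoint.star_eq] at this
  have h1 : star (e - f) * (e - f) = e - f := by
    rw [star_sub, he.isSelfAdjoint.star_eq, hf.isSelfAdjoint.star_eq, sub_mul, mul_sub, mul_sub,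
      hef, hfe, he.isIdempotentElem.eq, hf.isIdempotentElem.eq]
    abel
  have h2 : ‖e - f‖ = ‖e - f‖ * ‖e - f‖ := by
    rw [← CStarRing.norm_star_mul_self, h1]
  have h3 : ‖e - f‖ = 0 := by
    by_contra h4
    have : 0 < ‖e - f‖ := lt_of_le_of_ne (norm_nonneg _) (Ne.symm h4)
    nlinarith
  exact sub_eq_zero.1 (norm_eq_zero.1 h3)

theorem isStarProjection_of_star_mul_self {a : A} (h : IsStarProjection (star a * a)) :
    IsStarProjection (a * star a) ∧ IsStarProjection (star a * a) := by
  refine ⟨⟨?_, IsSelfAdjoint.mul_star_self a⟩, h⟩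
  rw [IsIdempotentElem, ← mul_assoc, mul_star_mul_self_of_isStarProjection h]

/-- An analytic germ at `1` of an inverse square root. -/
noncomputable def invSqrt : A → A := (exists_analytic_invSqrt A).choose

theorem analyticAt_invSqrt : AnalyticAt ℝ (invSqrt : A → A) 1 :=
  (exists_analytic_invSqrt A).choose_spec.1

theorem invSqrt_one : invSqrt (1 : A) = 1 := (exists_analytic_invSqrt A).choose_spec.2.1

theorem eventually_invSqrt : ∀ᶠ x : A in 𝓝 1,
    ‖invSqrt x - 1‖ < 1 ∧ invSqrt x * invSqrt x * x = 1 ∧ x * (invSqrt x * invSqrt x) = 1 := by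
  have h : Tendsto (fun x : A => ‖invSqrt x - 1‖) (𝓝 1) (𝓝 0) := by
    have := (analyticAt_invSqrt (A := A)).continuousAt.tendsto.sub_const 1 |>.norm
    simpa [invSqrt_one] using this
  exact (h.eventually_lt_const one_pos).and (exists_analytic_invSqrt A).choose_spec.2.2

/-- The square of the absolute value of `y p`, extended by `1` to the range of `1 - p`. -/
def gram (p y : A) : A := p * star y * y * p + 1 - p

/-- The polar part of `y p`, for `y p` close to a partial isometry with source `p`. -/
noncomputable def polar (p y : A) : A := y * p * invSqrt (gram p y)

/-- The inverse square root of the Gram element behaves as expected. -/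
def IsPolarizable (p y : A) : Prop :=
  ‖invSqrt (gram p y) - 1‖ < 1 ∧ invSqrt (gram p y) * invSqrt (gram p y) * gram p y = 1 ∧
    gram p y * (invSqrt (gram p y) * invSqrt (gram p y)) = 1

theorem gram_star_mul_self {a : A} (h : IsStarProjection (star a * a)) :
    gram (star a * a) a = 1 := by
  have h2 : star a * a * (star a * a) = star a * a := h.isIdempotentElem
  rw [gram, mul_assoc (star a * a) (star a) a, h2, h2]
  abel

theorem polar_star_mul_self {a : A} (h : IsStarProjection (star a * a)) :
    polar (star a * a) a = a := by
  rw [polar, gram_star_mul_self h, invSqrt_one, mul_one, ← mul_assoc,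
    mul_star_mul_self_of_isStarProjection h]

theorem IsStarProjection.star_mul_self {p : A} (hp : IsStarProjection p) : star p * p = p := by
  rw [hp.isSelfAdjoint.star_eq, hp.isIdempotentElem.eq]

theorem gram_self {p : A} (hp : IsStarProjection p) : gram p p = 1 := by
  have := gram_star_mul_self (a := p) (by rwa [hp.star_mul_self])
  rwa [hp.star_mul_self] at this

theorem polar_self {p : A} (hp : IsStarProjection p) : polar p p = p := by
  have := polar_star_mul_self (a := p) (by rwa [hp.star_mul_self])
  rwa [hp.star_mul_self] at this

theorem analyticAt_gram (z : A × A) : AnalyticAt ℝ (fun z : A × A => gram z.1 z.2) z :=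
  ((((analyticAt_fst.fun_mul analyticAt_snd.fun_star).fun_mul analyticAt_snd).fun_mul
    analyticAt_fst).fun_add analyticAt_const).fun_sub analyticAt_fst

theorem analyticAt_polar {z : A × A} (h : gram z.1 z.2 = 1) :
    AnalyticAt ℝ (fun z : A × A => polar z.1 z.2) z :=
  (analyticAt_snd.fun_mul analyticAt_fst).fun_mul
    (AnalyticAt.fun_comp (by rw [h]; exact analyticAt_invSqrt) (analyticAt_gram z))

theorem eventually_isPolarizable {z : A × A} (h : gram z.1 z.2 = 1) :
    ∀ᶠ z in 𝓝 z, IsPolarizable z.1 z.2 := by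
  have := (analyticAt_gram z).continuousAt.tendsto
  rw [h] at this
  exact this.eventually eventually_invSqrt

/-- With `h = w^(-1/2)` self-adjoint, commuting with `p` and acting as `1` on `1 - p`, the product
is `h (w - (1 - p)) h = 1 - (1 - p)`. Each property of `h` is a uniqueness statement for square
roots near `1`, obtained from a Sylvester equation. -/
theorem star_polar_mul_polar {p y : A} (hp : IsStarProjection p) (h : IsPolarizable p y) :
    star (polar p y) * polar p y = p ∧ polar p y * p = polar p y := by
  obtain ⟨h1, h2, h3⟩ := h
  have hps : star p = p := hp.isSelfAdjoint.star_eq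
  have hpp : p * p = p := hp.isIdempotentElem.eq
  rw [polar]
  set w := gram p y with hw
  set h := invSqrt w
  have hws : star w = w := by
    simp only [hw, gram, star_sub, star_add, star_mul, star_star, star_one, hps, mul_assoc]
  have hh2 : ∀ c : A, c * w = 1 → c = h * h := fun c hc => by
    calc c = c * (w * (h * h)) := by rw [h3, mul_one]
      _ = h * h := by rw [← mul_assoc, hc, one_mul]
  have hsn : ‖star h - 1‖ < 1 := by rwa [← star_one (R := A), ← star_sub, norm_star]
  -- Both are square roots of the inverse of `w`, so `c = h - h*` satisfies `h c + c h* = h² - h*² =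
  -- 0`.
  have hhs : star h = h := by
    have e : star h * star h = h * h := hh2 _ <| by
      have := congrArg star h3
      rwa [star_mul, star_mul, hws, star_one] at this
    have := eq_zero_of_mul_add_mul_eq_zero (x := h) (y := star h) (c := h - star h)
      (by rw [mul_sub, sub_mul, e]; abel) h1 hsn
    exact (sub_eq_zero.1 this).symm
  have hpw : p * w = w * p := by
    simp only [hw, gram, mul_sub, sub_mul, mul_add, add_mul, mul_assoc, hpp, mul_one, one_mul]
    simp only [← mul_assoc, hpp]
  -- `p` commutes with `w`, hence with `h²`, so the commutator `c` of `h` and `p` satisfies `h c + c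
  -- h = 0`.
  have hph : h * p = p * h := by
    have e : p * (h * h) = h * h * p := by
      calc p * (h * h) = h * h * w * p * (h * h) := by rw [h2, one_mul]
        _ = h * h * (w * p) * (h * h) := by simp only [mul_assoc]
        _ = h * h * p * (w * (h * h)) := by rw [← hpw]; simp only [mul_assoc]
        _ = h * h * p := by rw [h3, mul_one]
    have := eq_zero_of_mul_add_mul_eq_zero (x := h) (y := h) (c := h * p - p * h)
      (by
        rw [mul_sub, sub_mul, mul_assoc p, e, ← mul_assoc, ← mul_assoc]
        abel) h1 h1
    exact sub_eq_zero.1 this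
  have hw1 : w * (1 - p) = 1 - p := by
    simp only [hw, gram, sub_mul, add_mul, mul_assoc, mul_sub, mul_one, one_mul, hpp]
    abel
  -- Here `h² (1 - p) = 1 - p`, so the defect `c` satisfies `h c + c = 0`, a Sylvester equation with
  -- `y = 1`.
  have hh1 : h * (1 - p) = 1 - p := by
    have e : h * h * (1 - p) = 1 - p := by
      calc h * h * (1 - p) = h * h * w * (1 - p) := by rw [mul_assoc (h * h) w, hw1]
        _ = 1 - p := by rw [h2, one_mul]
    have := eq_zero_of_mul_add_mul_eq_zero (x := h) (y := 1) (c := h * (1 - p) - (1 - p))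
      (by rw [mul_sub, mul_one, ← mul_assoc, e]; abel) h1 (by simp)
    exact sub_eq_zero.1 this
  have hwh : w * h = h * w := by
    calc w * h = w * h * (h * h * w) := by rw [h2, mul_one]
      _ = w * (h * h) * (h * w) := by simp only [mul_assoc]
      _ = h * w := by rw [h3, one_mul]
  constructor
  · calc star (y * p * h) * (y * p * h) = h * (p * star y * y * p) * h := by
          simp only [star_mul, hps, hhs, mul_assoc]
      _ = h * (w - (1 - p)) * h := by
          congr 2
          rw [hw, gram]
          abel
      _ = h * (w * h) - h * (1 - p) * h := by simp only [mul_sub, sub_mul, mul_assoc]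
      _ = 1 - (1 - p) := by
          rw [hwh, ← mul_assoc, h2, hh1, sub_mul, one_mul, ← hph]
          congr 1
          rw [← hh1, mul_sub, mul_one]
      _ = p := by abel
  · rw [mul_assoc, hph, ← mul_assoc, mul_assoc y, hpp]

theorem isStarProjection_polar {p y : A} (hp : IsStarProjection p) (h : IsPolarizable p y) :
    IsStarProjection (polar p y * star (polar p y)) ∧
      IsStarProjection (star (polar p y) * polar p y) :=
  isStarProjection_of_star_mul_self (by rwa [(star_polar_mul_polar hp h).1])

/-- If `y` is close to a projection `p₀`, and so is the projection `p`, then the polar part of `y p`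
has target `y`. -/
theorem eventually_polar_mul_star {p₀ : A} (hp₀ : IsStarProjection p₀) :
    ∀ᶠ z : A × A in 𝓝 (p₀, p₀), IsStarProjection z.1 → IsStarProjection z.2 →
      IsPolarizable z.1 z.2 ∧ polar z.1 z.2 * star (polar z.1 z.2) = z.2 := by
  have ha := analyticAt_polar (z := (p₀, p₀)) (gram_self hp₀)
  have ht : Tendsto (fun z : A × A => ‖z.2 - polar z.1 z.2 * star (polar z.1 z.2)‖)
      (𝓝 (p₀, p₀)) (𝓝 0) := by
    have := (analyticAt_snd.fun_sub (ha.fun_mul ha.fun_star)).continuousAt.norm.tendsto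
    simpa [polar_self hp₀, hp₀.isSelfAdjoint.star_eq, hp₀.isIdempotentElem.eq] using this
  filter_upwards [eventually_isPolarizable (z := (p₀, p₀)) (gram_self hp₀),
    ht.eventually_lt_const one_pos] with z h1 h2 h3 h4
  -- The polar part starts with the factor `z.2`, so its target lies below `z.2`; being close to it,
  -- it is equal to it.
  refine ⟨h1, (eq_of_mul_eq_of_norm_sub_lt_one h4 (isStarProjection_polar h3 h1).1 ?_ h2).symm⟩
  simp only [polar, ← mul_assoc, h4.isIdempotentElem.eq]

theorem eventually_polar_mul_star_left {p₀ : A} (hp₀ : IsStarProjection p₀) :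
    ∀ᶠ q : A in 𝓝 p₀, IsStarProjection q →
      IsPolarizable p₀ q ∧ polar p₀ q * star (polar p₀ q) = q := by
  have : Tendsto (fun q : A => (p₀, q)) (𝓝 p₀) (𝓝 (p₀, p₀)) :=
    (Continuous.prodMk_right p₀).tendsto p₀
  filter_upwards [this.eventually (eventually_polar_mul_star hp₀)] with q h using h hp₀

/-- For `y` close to a projection `p`, the range projection of `y p`. -/
noncomputable def rangeProjection (p y : A) : A := polar p y * star (polar p y)

theorem analyticAt_polar_left {p y : A} (h : gram p y = 1) : AnalyticAt ℝ (polar p) y :=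
  AnalyticAt.fun_comp (f := fun y => (p, y)) (analyticAt_polar (z := (p, y)) h)
    (analyticAt_const.prod analyticAt_id)

theorem eventually_isPolarizable_left {p y : A} (h : gram p y = 1) :
    ∀ᶠ y in 𝓝 y, IsPolarizable p y :=
  ((Continuous.prodMk_right p).tendsto y).eventually (eventually_isPolarizable (z := (p, y)) h)

theorem analyticAt_rangeProjection {p : A} (hp : IsStarProjection p) :
    AnalyticAt ℝ (rangeProjection p) p :=
  (analyticAt_polar_left (gram_self hp)).fun_mul (analyticAt_polar_left (gram_self hp)).fun_star

theorem rangeProjection_self {p : A} (hp : IsStarProjection p) : rangeProjection p p = p := by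
  rw [rangeProjection, polar_self hp, hp.isSelfAdjoint.star_eq, hp.isIdempotentElem.eq]

theorem eventually_isStarProjection_rangeProjection {p : A} (hp : IsStarProjection p) :
    ∀ᶠ y in 𝓝 p, IsStarProjection (rangeProjection p y) := by
  filter_upwards [eventually_isPolarizable_left (gram_self hp)] with y hy
  exact (isStarProjection_polar hp hy).1

/-- A local retraction onto the set of partial isometries, near a partial isometry with
source `p`. -/
noncomputable def isometricPart (p y : A) : A := polar (rangeProjection p (star y * y)) y

theorem analyticAt_rangeProjection_pair {a : A} (ha : IsStarProjection (star a * a)) :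
    AnalyticAt ℝ (fun y => (rangeProjection (star a * a) (star y * y), y)) a :=
  ((analyticAt_rangeProjection ha).fun_comp_of_eq
    ((analyticAt_star a).fun_mul analyticAt_id) rfl).prod analyticAt_id

theorem analyticAt_isometricPart {a : A} (ha : IsStarProjection (star a * a)) :
    AnalyticAt ℝ (isometricPart (star a * a)) a :=
  (analyticAt_polar (z := (star a * a, a)) (gram_star_mul_self ha)).fun_comp_of_eq
    (analyticAt_rangeProjection_pair ha) (by rw [rangeProjection_self ha])

/-- The source of a nearby partial isometry may differ from `a* a`, so it is first estimated by a
projection depending analytically on `y`, the range projection of `y* y a* a`; then `y` is polarized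
relative to that projection. -/
theorem eventually_isometricPart {a : A} (ha : IsStarProjection (star a * a)) :
    ∀ᶠ y in 𝓝 a, IsStarProjection (isometricPart (star a * a) y *
        star (isometricPart (star a * a) y)) ∧
      IsStarProjection (star (isometricPart (star a * a) y) * isometricPart (star a * a) y) := by
  have h1 := (analyticAt_rangeProjection_pair ha).continuousAt.tendsto
  rw [rangeProjection_self ha] at h1
  have h2 : Tendsto (fun y : A => star y * y) (𝓝 a) (𝓝 (star a * a)) :=
    (continuous_star.mul continuous_id).tendsto a
  filter_upwards [h1.eventually
      (eventually_isPolarizable (z := (star a * a, a)) (gram_star_mul_self ha)),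
    h2.eventually (eventually_isStarProjection_rangeProjection ha)] with y h3 h4
  exact isStarProjection_polar h4 h3

/-- When `b` is a partial isometry the estimated source is exactly `b* b`, and polarizing `b`
relative to its own source changes nothing. -/
theorem eventually_isometricPart_eq {a : A} (ha : IsStarProjection (star a * a)) :
    ∀ᶠ b in 𝓝 a, IsStarProjection (star b * b) → isometricPart (star a * a) b = b := by
  have h2 : Tendsto (fun y : A => star y * y) (𝓝 a) (𝓝 (star a * a)) :=
    (continuous_star.mul continuous_id).tendsto a
  filter_upwards [h2.eventually (eventually_polar_mul_star_left ha)] with b h hb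
  rw [isometricPart, rangeProjection, (h hb).2, polar_star_mul_self hb]

end Polar

/-! ### The manifolds and the groupoid of partial isometries -/

section Groupoid

variable (A : Type u) [CStarAlgebra A]

theorem isClosed_isStarProjection : IsClosed {p : A | IsStarProjection p} := by
  have : {p : A | IsStarProjection p} = {p | p * p = p} ∩ {p | star p = p} := by
    ext p
    exact ⟨fun h => ⟨h.1, h.2⟩, fun h => ⟨h.1, h.2⟩⟩
  rw [this]
  exact (isClosed_eq (continuous_id.mul continuous_id) continuous_id).inter
    (isClosed_eq continuous_star continuous_id)

theorem isClosedEmbedding_projections : IsClosedEmbedding (fun p : Projections A => p.1) :=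
  (isClosed_isStarProjection A).isClosedEmbedding_subtypeVal

theorem isClosedEmbedding_partialIsometries :
    IsClosedEmbedding (fun a : PartialIsometries A => a.1) :=
  IsClosed.isClosedEmbedding_subtypeVal <|
    ((isClosed_isStarProjection A).preimage (continuous_id.mul continuous_star)).inter
      ((isClosed_isStarProjection A).preimage (continuous_star.mul continuous_id))

theorem isAnalyticRetract_projections : IsAnalyticRetract (fun p : Projections A => p.1) where
  isEmbedding := (isClosedEmbedding_projections A).isEmbedding
  exists_retraction p := by
    refine ⟨rangeProjection p.1, analyticAt_rangeProjection p.2, ?_, ?_⟩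
    · filter_upwards [eventually_isStarProjection_rangeProjection p.2] with y hy
      exact ⟨⟨_, hy⟩, rfl⟩
    · filter_upwards [continuous_subtype_val.continuousAt.eventually
        (eventually_polar_mul_star_left p.2)] with q hq
      exact (hq q.2).2

theorem isAnalyticRetract_partialIsometries :
    IsAnalyticRetract (fun a : PartialIsometries A => a.1) where
  isEmbedding := (isClosedEmbedding_partialIsometries A).isEmbedding
  exists_retraction a := by
    refine ⟨isometricPart (star a.1 * a.1), analyticAt_isometricPart a.2.2, ?_, ?_⟩
    · filter_upwards [eventually_isometricPart a.2.2] with y hy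
      exact ⟨⟨_, hy⟩, rfl⟩
    · filter_upwards [continuous_subtype_val.continuousAt.eventually
        (eventually_isometricPart_eq a.2.2)] with b hb
      exact hb b.2.2

theorem isClosedEmbedding_composable : IsClosedEmbedding
    (fun c : (partialIsometryGroupoid A).Composable => c.1) := by
  refine IsClosed.isClosedEmbedding_subtypeVal
    (X := PartialIsometries A × PartialIsometries A) (isClosed_eq ?_ ?_)
  · exact Continuous.subtype_mk (by fun_prop) _
  · exact Continuous.subtype_mk (by fun_prop) _

/-- Translating `b` by the canonical arrow from the target of `b` to a nearby projection `p` gives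
a partial isometry with target `p`. -/
theorem isStarProjection_polar_mul {p b : A}
    (hb : IsStarProjection (b * star b) ∧ IsStarProjection (star b * b))
    (h : IsPolarizable (b * star b) p)
    (h' : polar (b * star b) p * star (polar (b * star b) p) = p) :
    star (polar (b * star b) p * b) * (polar (b * star b) p * b) = star b * b ∧
      polar (b * star b) p * b * star (polar (b * star b) p * b) = p := by
  obtain ⟨h1, h2⟩ := star_polar_mul_polar hb.1 h
  set v := polar (b * star b) p
  constructor
  · calc star (v * b) * (v * b) = star b * (star v * v) * b := by
          simp only [star_mul, mul_assoc]
      _ = star b * (b * star b * b) := by rw [h1]; simp only [mul_assoc]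
      _ = star b * b := by rw [mul_star_mul_self_of_isStarProjection hb.2]
  · calc v * b * star (v * b) = v * (b * star b) * star v := by
          simp only [star_mul, mul_assoc]
      _ = p := by rw [h2, h']

theorem isAnalyticRetract_composable : IsAnalyticRetract
    (fun c : (partialIsometryGroupoid A).Composable => (c.1.1.1, c.1.2.1)) where
  isEmbedding := (((isClosedEmbedding_partialIsometries A).isEmbedding.prodMap
    (isClosedEmbedding_partialIsometries A).isEmbedding).comp
      (isClosedEmbedding_composable A).isEmbedding)
  exists_retraction c := by
    obtain ⟨⟨a, b⟩, hab⟩ := c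
    have hab' : star a.1 * a.1 = b.1 * star b.1 := congrArg Subtype.val hab
    have hf : AnalyticAt ℝ (fun z : A × A => isometricPart (star a.1 * a.1) z.1) (a.1, b.1) :=
      (analyticAt_isometricPart a.2.2).fun_comp_of_eq analyticAt_fst rfl
    have hg : AnalyticAt ℝ (fun z : A × A => isometricPart (star b.1 * b.1) z.2) (a.1, b.1) :=
      (analyticAt_isometricPart b.2.2).fun_comp_of_eq analyticAt_snd rfl
    have hfa : isometricPart (star a.1 * a.1) a.1 = a.1 :=
      (eventually_isometricPart_eq a.2.2).self_of_nhds a.2.2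
    have hgb : isometricPart (star b.1 * b.1) b.1 = b.1 :=
      (eventually_isometricPart_eq b.2.2).self_of_nhds b.2.2
    set f : A × A → A := fun z => isometricPart (star a.1 * a.1) z.1
    set g : A × A → A := fun z => isometricPart (star b.1 * b.1) z.2
    have hpair : AnalyticAt ℝ (fun z => (g z * star (g z), star (f z) * f z)) (a.1, b.1) :=
      (hg.fun_mul hg.fun_star).prod (hf.fun_star.fun_mul hf)
    have hval : (g (a.1, b.1) * star (g (a.1, b.1)), star (f (a.1, b.1)) * f (a.1, b.1)) =
        (b.1 * star b.1, b.1 * star b.1) := by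
      simp only [f, g]
      rw [hfa, hgb, hab']
    have ht := hpair.continuousAt.tendsto
    rw [hval] at ht
    -- Retract both entries to partial isometries, then move the target of the second to the source
    -- of the first by the canonical arrow between these nearby projections.
    refine ⟨fun z => (f z, polar (g z * star (g z)) (star (f z) * f z) * g z), ?_, ?_, ?_⟩
    · exact hf.prod (((analyticAt_polar (z := (b.1 * star b.1, b.1 * star b.1))
        (gram_self b.2.1)).fun_comp_of_eq hpair hval).fun_mul hg)
    · filter_upwards [ht.eventually (eventually_polar_mul_star b.2.1),
        (continuous_fst.tendsto (a.1, b.1)).eventually (eventually_isometricPart a.2.2),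
        (continuous_snd.tendsto (a.1, b.1)).eventually (eventually_isometricPart b.2.2)]
        with z h1 h2 h3
      obtain ⟨h4, h5⟩ := h1 h3.1 h2.2
      obtain ⟨h6, h7⟩ := isStarProjection_polar_mul A h3 h4 h5
      exact ⟨⟨(⟨f z, h2⟩, ⟨_, isStarProjection_of_star_mul_self (by rw [h6]; exact h3.2)⟩),
        Subtype.ext h7.symm⟩, rfl⟩
    · have hι : Continuous
          (fun c : (partialIsometryGroupoid A).Composable => (c.1.1.1, c.1.2.1)) :=
        (continuous_subtype_val.prodMap continuous_subtype_val).comp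
          (isClosedEmbedding_composable A).continuous
      have k1 := (hι.tendsto ⟨(a, b), hab⟩).fst_nhds.eventually (eventually_isometricPart_eq a.2.2)
      have k2 := (hι.tendsto ⟨(a, b), hab⟩).snd_nhds.eventually (eventually_isometricPart_eq b.2.2)
      filter_upwards [k1, k2] with d h1 h2
      have e1 : f (d.1.1.1, d.1.2.1) = d.1.1.1 := h1 d.1.1.2.2
      have e2 : g (d.1.1.1, d.1.2.1) = d.1.2.1 := h2 d.1.2.2.2
      have e3 : star d.1.1.1 * d.1.1.1 = d.1.2.1 * star d.1.2.1 := congrArg Subtype.val d.2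
      -- On a composable pair the two projections agree, so the connecting arrow is an identity.
      rw [e1, e2, e3, polar_self d.1.2.2.1, mul_star_mul_self_of_isStarProjection d.1.2.2.2]

/-! ### The unitary group, the isotropy group and the Lie groupoid structure -/

variable {A}

theorem gram_one_of_unitary {a : A} (ha : star a * a = 1) : gram 1 a = 1 := by
  have := gram_star_mul_self (a := a) (by rw [ha]; exact IsStarProjection.one A)
  rwa [ha] at this

/-- A set of elements of `A` whose range is the unitary group is a local analytic retract. -/
theorem isAnalyticRetract_of_range_eq_unitary {M : Type u} [TopologicalSpace M] {ι : M → A}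
    (hι : IsEmbedding ι) (hr : Set.range ι = {a | star a * a = 1 ∧ a * star a = 1}) :
    IsAnalyticRetract ι where
  isEmbedding := hι
  exists_retraction x := by
    have hu : ∀ y, star (ι y) * ι y = 1 ∧ ι y * star (ι y) = 1 := fun y => by
      have : ι y ∈ Set.range ι := ⟨y, rfl⟩
      rwa [hr] at this
    have hp : ∀ y, polar 1 (ι y) = ι y := fun y => by
      have := polar_star_mul_self (a := ι y) (by rw [(hu y).1]; exact IsStarProjection.one A)
      rwa [(hu y).1] at this
    have ha : AnalyticAt ℝ (polar 1) (ι x) := analyticAt_polar_left (gram_one_of_unitary (hu x).1)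
    -- Polarizing relative to `1` gives only an isometry. Its target is a projection close to `1`,
    -- hence equal to `1`.
    have ht : Tendsto (fun y => ‖1 - polar 1 y * star (polar 1 y)‖) (𝓝 (ι x)) (𝓝 0) := by
      have := ((analyticAt_const (v := (1 : A))).fun_sub
        (ha.fun_mul ha.fun_star)).continuousAt.norm.tendsto
      simpa [hp, (hu x).2] using this
    refine ⟨polar 1, ha, ?_, Eventually.of_forall hp⟩
    filter_upwards [eventually_isPolarizable_left (gram_one_of_unitary (hu x).1),
      ht.eventually_lt_const one_pos] with y h1 h2
    rw [hr]
    have h3 := isStarProjection_polar (IsStarProjection.one A) h1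
    exact ⟨(star_polar_mul_polar (IsStarProjection.one A) h1).1,
      (eq_of_mul_eq_of_norm_sub_lt_one (IsStarProjection.one A) h3.1 (one_mul _) h2).symm⟩

variable (A)

theorem isAnalyticRetract_unitary : IsAnalyticRetract (fun a : unitary A => (a : A)) :=
  isAnalyticRetract_of_range_eq_unitary IsEmbedding.subtypeVal (by
    ext a
    rw [Set.mem_ofPred_eq, ← Unitary.mem_iff]
    exact ⟨fun ⟨b, hb⟩ => hb ▸ b.2, fun h => ⟨⟨a, h⟩, rfl⟩⟩)

theorem isClosedEmbedding_isotropy : IsClosedEmbedding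
    (fun g : (partialIsometryGroupoid A).Isotropy (oneProjection A) => g.1) := by
  refine IsClosed.isClosedEmbedding_subtypeVal (X := PartialIsometries A)
    (IsClosed.inter (isClosed_eq ?_ continuous_const) (isClosed_eq ?_ continuous_const))
  · exact Continuous.subtype_mk (by fun_prop) _
  · exact Continuous.subtype_mk (by fun_prop) _

theorem isAnalyticRetract_isotropy : IsAnalyticRetract
    (fun g : (partialIsometryGroupoid A).Isotropy (oneProjection A) => g.1.1) :=
  isAnalyticRetract_of_range_eq_unitary
    ((isClosedEmbedding_partialIsometries A).isEmbedding.comp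
      (isClosedEmbedding_isotropy A).isEmbedding) (by
    ext a
    constructor
    · rintro ⟨g, rfl⟩
      exact ⟨congrArg Subtype.val g.2.1, congrArg Subtype.val g.2.2⟩
    · rintro ⟨h1, h2⟩
      refine ⟨⟨⟨a, ?_⟩, Subtype.ext h1, Subtype.ext h2⟩, rfl⟩
      rw [h1, h2]
      exact ⟨IsStarProjection.one A, IsStarProjection.one A⟩)

/-- The isotropy group at the unit is the unitary group. -/
def isotropyEquivUnitary :
    (partialIsometryGroupoid A).Isotropy (oneProjection A) ≃* unitary A where
  toFun g := ⟨g.1.1, Unitary.mem_iff.2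
    ⟨congrArg Subtype.val g.2.1, congrArg Subtype.val g.2.2⟩⟩
  invFun a := ⟨⟨a.1, by
    rw [Unitary.mul_star_self_of_mem a.2, Unitary.star_mul_self_of_mem a.2]
    exact ⟨IsStarProjection.one A, IsStarProjection.one A⟩⟩,
    Subtype.ext (Unitary.star_mul_self_of_mem a.2), Subtype.ext (Unitary.mul_star_self_of_mem a.2)⟩
  left_inv _ := rfl
  right_inv _ := rfl
  map_mul' _ _ := rfl

/-- A topological group embedded in `A` with the multiplication and involution of `A` is a
Banach-Lie group for every atlas realized by the embedding. -/
theorem Realizes.isAnalyticBanachLieGroup {A : Type u} [CStarAlgebra A] {G : Type u} [Group G]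
    [TopologicalSpace G] {𝒢 : AnalyticAtlas G} {ι : G → A} (h : Realizes 𝒢 ι)
    (hmul : ∀ g g', ι (g * g') = ι g * ι g') (hinv : ∀ g, ι g⁻¹ = star (ι g)) :
    IsAnalyticBanachLieGroup 𝒢 :=
  ⟨h.isEmbedding.t2Space,
    (h.prod h).isAnalyticMap h fun _ => ⟨fun z => z.1 * z.2, analyticAt_fst.fun_mul analyticAt_snd,
      Eventually.of_forall fun _ => hmul _ _⟩,
    h.isAnalyticMap h fun _ => ⟨star, analyticAt_star _, Eventually.of_forall hinv⟩⟩

/-- The source map has local analytic sections. -/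
theorem exists_section_source (a : PartialIsometries A) :
    ∃ (σ : Projections A → PartialIsometries A) (τ : A → A),
      σ ((partialIsometryGroupoid A).s a) = a ∧
      (∀ᶠ q in 𝓝 ((partialIsometryGroupoid A).s a), (partialIsometryGroupoid A).s (σ q) = q) ∧
      AnalyticAt ℝ τ ((partialIsometryGroupoid A).s a).1 ∧
      ∀ᶠ q in 𝓝 ((partialIsometryGroupoid A).s a), (σ q).1 = τ q.1 := by
  classical
  let p : A := star a.1 * a.1
  have hp : IsStarProjection p := a.2.2
  -- With `v = polar p q` an arrow from `p` to `q`, the product `a v*` has source `v p v* = v v* =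
  -- q`.
  let τ : A → A := fun q => a.1 * star (polar p q)
  have hτ : AnalyticAt ℝ τ p := analyticAt_const.fun_mul
    (analyticAt_polar_left (gram_self hp)).fun_star
  have hτp : τ p = a.1 := by
    simp only [τ, polar_self hp, hp.isSelfAdjoint.star_eq]
    rw [← mul_assoc, mul_star_mul_self_of_isStarProjection a.2.2]
  have hev : ∀ᶠ q in 𝓝 p, IsStarProjection q → star (τ q) * τ q = q := by
    filter_upwards [eventually_polar_mul_star_left hp] with q h hq
    obtain ⟨h1, h2⟩ := h hq
    calc star (τ q) * τ q = polar p q * p * star (polar p q) := by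
          simp only [τ, p, star_mul, star_star, mul_assoc]
      _ = q := by rw [(star_polar_mul_polar hp h1).2, h2]
  have hcont : Tendsto (fun q : Projections A => q.1) (𝓝 ((partialIsometryGroupoid A).s a))
    (𝓝 p) := continuous_subtype_val.tendsto ((partialIsometryGroupoid A).s a)
  -- The value `a` is a filler away from the point, where `τ q` need not have source `q`.
  let σ : Projections A → PartialIsometries A := fun q =>
    if h : star (τ q.1) * τ q.1 = q.1 then
      ⟨τ q.1, isStarProjection_of_star_mul_self (by rw [h]; exact q.2)⟩ else a
  have hσ : ∀ q : Projections A, star (τ q.1) * τ q.1 = q.1 → (σ q).1 = τ q.1 := fun q h => by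
    simp only [σ, dif_pos h]
  refine ⟨σ, τ, Subtype.ext ?_, ?_, hτ, ?_⟩
  · exact (hσ _ (by change star (τ p) * τ p = p; rw [hτp])).trans hτp
  · filter_upwards [hcont.eventually hev] with q hq
    apply Subtype.ext
    change star (σ q).1 * (σ q).1 = q.1
    rw [hσ q (hq q.2), hq q.2]
  · filter_upwards [hcont.eventually hev] with q hq using hσ q (hq q.2)

theorem isTopological_partialIsometryGroupoid : (partialIsometryGroupoid A).IsTopological := by
  have hs : Continuous (partialIsometryGroupoid A).s := Continuous.subtype_mk (by fun_prop) _
  have ht : Continuous (partialIsometryGroupoid A).t := Continuous.subtype_mk (by fun_prop) _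
  have hi : Continuous (partialIsometryGroupoid A).inv :=
    Continuous.subtype_mk (by fun_prop) _
  have hii : Function.Involutive (partialIsometryGroupoid A).inv := fun a =>
    Subtype.ext (star_star a.1)
  have hsopen : IsOpenMap (partialIsometryGroupoid A).s := by
    rw [isOpenMap_iff_nhds_le]
    intro a U hU
    -- A map with a continuous local section through every point is open.
    obtain ⟨σ, τ, hσ, hsσ, hτ, hστ⟩ := exists_section_source A a
    have hc : ContinuousAt σ ((partialIsometryGroupoid A).s a) := by
      rw [(isClosedEmbedding_partialIsometries A).isEmbedding.continuousAt_iff]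
      exact (hτ.continuousAt.comp (f := Subtype.val) continuous_subtype_val.continuousAt).congr
        (EventuallyEq.symm hστ)
    have hc' := hc.tendsto
    rw [hσ] at hc'
    filter_upwards [hc' hU, hsσ] with q h1 h2
    have h3 : (partialIsometryGroupoid A).s (σ q) ∈ U := h1
    rwa [h2] at h3
  have hinv : IsHomeomorph (partialIsometryGroupoid A).inv :=
    (Homeomorph.mk hii.toPerm hi hi).isHomeomorph
  have hst : (partialIsometryGroupoid A).t =
      (partialIsometryGroupoid A).s ∘ (partialIsometryGroupoid A).inv :=
    funext fun g => ((partialIsometryGroupoid A).s_inv g).symm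
  exact
  { t2_base := inferInstance
    continuous_s := hs
    surjective_s := fun p => ⟨_, (partialIsometryGroupoid A).s_one p⟩
    isOpenMap_s := hsopen
    continuous_t := ht
    surjective_t := fun p => ⟨_, (partialIsometryGroupoid A).t_one p⟩
    isOpenMap_t := by
      rw [hst]
      exact hsopen.comp hinv.isOpenMap
    continuous_mul := by
      have := (isAnalyticRetract_composable A).isEmbedding.continuous
      exact Continuous.subtype_mk (this.fst.mul this.snd) _
    isEmbedding_one := IsEmbedding.of_leftInverse (partialIsometryGroupoid A).s_one hs
      (Continuous.subtype_mk continuous_subtype_val _)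
    isHomeomorph_inv := hinv }

theorem isLocallyTransitive_partialIsometryGroupoid :
    (partialIsometryGroupoid A).IsLocallyTransitive := by
  intro x
  rw [isOpen_iff_mem_nhds]
  rintro _ ⟨g, hg, rfl⟩
  have ht : Tendsto (fun q : Projections A => q.1) (𝓝 ((partialIsometryGroupoid A).t g))
    (𝓝 (g.1 * star g.1)) := continuous_subtype_val.tendsto ((partialIsometryGroupoid A).t g)
  filter_upwards [ht.eventually (eventually_polar_mul_star_left g.2.1)] with q hq
  obtain ⟨h1, h2⟩ := hq q.2
  obtain ⟨h3, h4⟩ := isStarProjection_polar_mul A g.2 h1 h2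
  -- Following `g` by the canonical arrow from its target to `q` keeps the source and reaches `q`.
  let k : PartialIsometries A := ⟨polar (g.1 * star g.1) q.1 * g.1,
    isStarProjection_of_star_mul_self (by rw [h3]; exact g.2.2)⟩
  have hk : (partialIsometryGroupoid A).s k = (partialIsometryGroupoid A).s g := Subtype.ext h3
  exact ⟨k, hk.trans hg, Subtype.ext h4⟩

theorem isAnalyticBanachLie_partialIsometryGroupoid :
    (partialIsometryGroupoid A).IsAnalyticBanachLie
      (isAnalyticRetract_partialIsometries A).atlas (isAnalyticRetract_projections A).atlas := by
  have hG := (isAnalyticRetract_partialIsometries A).realizes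
  have hM := (isAnalyticRetract_projections A).realizes
  have hC := (isAnalyticRetract_composable A).realizes
  have htop := isTopological_partialIsometryGroupoid A
  exact
  { isTopological := htop
    t2_total := inferInstance
    submersion_s := hG.isAnalyticSubmersion hM htop.surjective_s
      (fun a => ⟨fun y => star y * y, (analyticAt_star _).fun_mul analyticAt_id,
        Eventually.of_forall fun _ => rfl⟩)
      (exists_section_source A)
    analytic_t := hG.isAnalyticMap hM fun a => ⟨fun y => y * star y,
      analyticAt_id.fun_mul (analyticAt_star _), Eventually.of_forall fun _ => rfl⟩
    analytic_inv := hG.isAnalyticMap hG fun a => ⟨star, analyticAt_star _,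
      Eventually.of_forall fun _ => rfl⟩
    analytic_one := hM.isAnalyticMap hG fun p => ⟨id, analyticAt_id,
      Eventually.of_forall fun _ => rfl⟩
    analytic_mul := ⟨(isAnalyticRetract_composable A).atlas,
      (hG.prod hG).isAnalyticSubmanifold hC (isClosedEmbedding_composable A),
      hC.isAnalyticMap hG fun c => ⟨fun z => z.1 * z.2, analyticAt_fst.fun_mul analyticAt_snd,
        Eventually.of_forall fun _ => rfl⟩⟩ }

end Groupoid

theorem theorem7p6 (A : Type u) [CStarAlgebra A] :
    ∃ (𝒢 : AnalyticAtlas (PartialIsometries A)) (ℳ : AnalyticAtlas (Projections A)),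
      -- the manifold structures are those of real analytic submanifolds of the Banach space `A`
      IsAnalyticSubmanifold 𝒢 (AnalyticAtlas.ofBanach A) (fun a => a.1) ∧
      IsAnalyticSubmanifold ℳ (AnalyticAtlas.ofBanach A) (fun p => p.1) ∧
      (partialIsometryGroupoid A).IsAnalyticBanachLie 𝒢 ℳ ∧
      (partialIsometryGroupoid A).IsLocallyTransitive ∧
      -- the isotropy group at `1` is the Banach-Lie group of unitary elements
      ∃ (ℐ : AnalyticAtlas ((partialIsometryGroupoid A).Isotropy (oneProjection A)))
        (𝒰 : AnalyticAtlas (unitary A)),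
        IsAnalyticSubmanifold ℐ 𝒢 (fun g => g.1) ∧ IsAnalyticBanachLieGroup ℐ ∧
        IsAnalyticSubmanifold 𝒰 (AnalyticAtlas.ofBanach A) (fun a => a.1) ∧
        IsAnalyticBanachLieGroup 𝒰 ∧
        ∃ φ : (partialIsometryGroupoid A).Isotropy (oneProjection A) ≃* unitary A,
          (∀ g, (φ g : A) = g.1.1) ∧ IsAnalyticMap ℐ 𝒰 φ ∧ IsAnalyticMap 𝒰 ℐ φ.symm := by
  have hG := (isAnalyticRetract_partialIsometries A).realizes
  have hM := (isAnalyticRetract_projections A).realizes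
  have hI := (isAnalyticRetract_isotropy A).realizes
  have hU := (isAnalyticRetract_unitary A).realizes
  have hA : Realizes (AnalyticAtlas.ofBanach A) (fun x : A => x) := Realizes.ofBanach
  have hUc : IsClosedEmbedding (fun a : unitary A => (a : A)) :=
    isClosed_unitary.isClosedEmbedding_subtypeVal
  exact ⟨_, _, hA.isAnalyticSubmanifold hG (isClosedEmbedding_partialIsometries A),
    hA.isAnalyticSubmanifold hM (isClosedEmbedding_projections A),
    isAnalyticBanachLie_partialIsometryGroupoid A,
    isLocallyTransitive_partialIsometryGroupoid A, _, _,
    hG.isAnalyticSubmanifold hI (isClosedEmbedding_isotropy A),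
    hI.isAnalyticBanachLieGroup (fun _ _ => rfl) (fun _ => rfl),
    hA.isAnalyticSubmanifold hU hUc,
    hU.isAnalyticBanachLieGroup (fun _ _ => rfl) (fun _ => rfl),
    isotropyEquivUnitary A, fun _ => rfl,
    hI.isAnalyticMap hU fun _ => ⟨id, analyticAt_id, Eventually.of_forall fun _ => rfl⟩,
    hU.isAnalyticMap hI fun _ => ⟨id, analyticAt_id, Eventually.of_forall fun _ => rfl⟩⟩
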